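/- Let $0<\delta<1/2$. There are constants $c_1,c_2>0$, depending only on $\delta$, such that for every odd prime $p$, all integers $n$ and $d$ with $1\le d\le\delta n$, and every $j\in\mathbb{F}_p^*=\mathbb{F}_p\setminus\{0\}$, $$\Pr_{f}\bigl[\,|\mathrm{bias}_j(f)|>p^{-c_1 n/d}\,\bigr]\le p^{-c_2|\mathcal{M}_p(d,n)|}.$$ Here $\mathcal{M}_p(d,n)$ is the set of monic monomials $x_1^{e_1}\cdots x_n^{e_n}$ with $0\le e_i\le p-1$ for all $i$ and $e_1+\dots+e_n\le d$; the polynomial $f$ is chosen uniformly at random from $\mathcal{P}_p(d,n)$, the set of all $\mathbb{F}_p$-linear combinations of monomials in $\mathcal{M}_p(d,n)$ (that is, polynomials of total degree at most $d$ in $n$ variables over $\mathbb{F}_p$, of degree at most $p-1$ in each variable); and $$\mathrm{bias}_j(f)=\frac1{p^n}\sum_{x\in\mathbb{F}_p^n}\omega^{j\cdot f(x)},\qquad \omega=e^{2\pi i/p}.$$ -/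

import Mathlib

namespace RMBias

/-- The monic monomials of degree at most `d` in `n` variables over `F_p`, as exponent vectors.
Monomials are reduced: since `x ^ p = x` on `F_p`, every individual exponent is at most `p - 1`. -/
def monomials (p d n : ℕ) : Set (Fin n →₀ ℕ) :=
  {e | (∀ i, e i < p) ∧ ∑ i, e i ≤ d}

/-- The polynomials of degree at most `d` in `n` variables over `F_p`, reduced in the same sense
(each variable occurs with exponent at most `p - 1`), so that distinct elements are distinct
functions on `F_p ^ n`, i.e. distinct codewords of the Reed-Muller code. -/
def polys (p d n : ℕ) : Set (MvPolynomial (Fin n) (ZMod p)) :=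
  {f | (∀ i, f.degreeOf i < p) ∧ f.totalDegree ≤ d}

/-- The `j`-th order bias `p ^ (-n) * ∑ x, ω ^ (j * f x)` with `ω = exp (2 π i / p)`;
`ZMod.stdAddChar` is the additive character `a ↦ ω ^ a` of `F_p`, see `bias_eq`. -/
noncomputable def bias (p n : ℕ) [NeZero p] (j : ZMod p) (f : (Fin n → ZMod p) → ZMod p) : ℂ :=
  1 / (p : ℂ) ^ n * ∑ x : Fin n → ZMod p, ZMod.stdAddChar (j * f x)

/-- The probability that a uniformly random element of the finite set `S` satisfies `E`. -/
noncomputable def unifProb {α : Type*} (S : Set α) (E : α → Prop) : ℝ :=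
  ({x | x ∈ S ∧ E x}.ncard : ℝ) / (S.ncard : ℝ)

theorem bias_eq (p n : ℕ) [NeZero p] (j : ZMod p) (f : (Fin n → ZMod p) → ZMod p) :
    bias p n j f = 1 / (p : ℂ) ^ n * ∑ x : Fin n → ZMod p,
      Complex.exp (2 * Real.pi * Complex.I / p) ^ (j * f x).val := by
  unfold bias
  congr 1
  refine Finset.sum_congr rfl fun x _ => ?_
  rw [ZMod.stdAddChar_apply, ZMod.toCircle_apply, ← Complex.exp_nat_mul]
  congr 1
  ring

theorem monomials_finite (p d n : ℕ) : (monomials p d n).Finite := by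
  refine Set.Finite.of_injOn (f := fun e : Fin n →₀ ℕ => (e : Fin n → ℕ))
    (t := Set.Iic fun _ => p) ?_ (fun a _ b _ h => DFunLike.coe_injective h) (Set.finite_Iic _)
  intro e he i
  exact (he.1 i).le

theorem mem_polys_iff {p d n : ℕ} (hp : 0 < p) (f : MvPolynomial (Fin n) (ZMod p)) :
    f ∈ polys p d n ↔ ∀ e ∈ f.support, e ∈ monomials p d n := by
  simp only [polys, monomials, Set.mem_ofPred_eq, MvPolynomial.degreeOf_lt_iff hp,
    MvPolynomial.totalDegree, Finset.sup_le_iff]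
  constructor
  · rintro ⟨h1, h2⟩ e he
    refine ⟨fun i => h1 i e he, ?_⟩
    have := h2 e he
    rwa [Finsupp.sum_fintype _ _ (fun _ => rfl)] at this
  · intro h
    refine ⟨fun i e he => (h e he).1 i, fun e he => ?_⟩
    have := (h e he).2
    rwa [Finsupp.sum_fintype _ _ (fun _ => rfl)]


theorem polys_finite (p d n : ℕ) [NeZero p] : (polys p d n).Finite := by
  classical
  have := (monomials_finite p d n).to_subtype
  refine Set.Finite.of_injOn
    (f := fun f (e : monomials p d n) => MvPolynomial.coeff (e : Fin n →₀ ℕ) f)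
    (t := Set.univ) (fun _ _ => Set.mem_univ _) ?_ Set.finite_univ
  intro f hf g hg h
  rw [mem_polys_iff (NeZero.pos p)] at hf hg
  ext e
  by_cases he : e ∈ monomials p d n
  · exact congrFun h ⟨e, he⟩
  · rw [MvPolynomial.notMem_support_iff.1 fun h' => he (hf e h'),
      MvPolynomial.notMem_support_iff.1 fun h' => he (hg e h')]

end RMBias

/-! ### Evaluation vectors of reduced monomials. -/

namespace RMBias

open Finset Module

/-! The proof is a moment method. By orthogonality of characters, the moment of order `8 * R` of the
bias is at most the fraction of `8 * R`-tuples of points whose signed sum of evaluations kills every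
polynomial of degree at most `d = D + 1` (`sum_norm_pow_le`). Write `n = m + N` with `N = m + r`,
and test only products of one of the first `m` variables with a monomial of degree at most `D` in
the other `N` (`card_annihilating_le`). The first `m` coordinates then give `m` independent choices
of a linear relation among the evaluation vectors of the remaining parts `b k`. If these vectors
have rank at least `R`, each relation has probability at most `p ^ (-R)`, in total `p ^ (-m * R)`.
If not, fewer than `R` of them span the rest, so at least `7 * R` points lie in a set of size at
most `p ^ r` instead of `p ^ N`, which saves `p ^ (7 * m * R)` against `2 ^ (8 * R)` choices of the
spanning indices (`card_tensor_relations_le`). The bound `p ^ r` comes from hashing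
(`card_monoEval_mem_lt`): some affine map to `F_p ^ r` sends any `p ^ r` points onto half of an
interpolation set, so their evaluation vectors span at least half the dimension of the polynomials
in `r` variables. With `m` of order `n / d` and `R` about half that dimension, `m * R` is at least a
constant times the number of monomials, and Markov's inequality concludes. -/

/-- Reduced exponent vectors of total degree at most `D` in the variables `ι`. -/
abbrev ReducedExp (p D : ℕ) (ι : Type*) [Fintype ι] : Type _ :=
  {e : ι → Fin p // ∑ i, (e i : ℕ) ≤ D}

/-- The values at `x` of all reduced monomials of degree at most `D`. -/
def monoEval {p : ℕ} (D : ℕ) {ι : Type*} [Fintype ι] (x : ι → ZMod p) :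
    ReducedExp p D ι → ZMod p :=
  fun e => ∏ i, x i ^ (e.1 i : ℕ)

/-- An exponent can be lowered below `p` without changing the power function on `F_p`. -/
theorem exists_reduced_pow (p : ℕ) [Fact p.Prime] (e : ℕ) :
    ∃ k : Fin p, (k : ℕ) ≤ e ∧ ∀ x : ZMod p, x ^ (k : ℕ) = x ^ e := by
  induction e using Nat.strong_induction_on with
  | _ e ih =>
    have hp := (Fact.out : p.Prime).two_le
    by_cases he : e < p
    · exact ⟨⟨e, he⟩, le_rfl, fun _ => rfl⟩
    · obtain ⟨k, hk, hx⟩ := ih (e - p + 1) (by omega)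
      refine ⟨k, by omega, fun x => ?_⟩
      rw [hx, pow_succ]
      nth_rw 2 [← ZMod.pow_card x]
      rw [← pow_add]
      congr 1
      omega

theorem exists_reducedExp {p : ℕ} [Fact p.Prime] {D : ℕ} {ι : Type*} [Fintype ι] (e : ι → ℕ)
    (he : ∑ i, e i ≤ D) :
    ∃ k : ReducedExp p D ι, ∀ x : ι → ZMod p, monoEval D x k = ∏ i, x i ^ e i := by
  choose k hk hx using fun i => exists_reduced_pow p (e i)
  exact ⟨⟨k, (sum_le_sum fun i _ => hk i).trans he⟩,
    fun x => prod_congr rfl fun i _ => hx i (x i)⟩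

/-- A linear relation between the vectors `monoEval D (x k)` holds for all polynomials of degree
at most `D`. -/
theorem sum_eval_eq_zero {p : ℕ} [Fact p.Prime] {D : ℕ} {ι κ : Type*} [Fintype ι] [Fintype κ]
    (x : κ → ι → ZMod p) (c : κ → ZMod p) (h : ∑ k, c k • monoEval D (x k) = 0)
    (q : MvPolynomial ι (ZMod p)) (hq : q.totalDegree ≤ D) :
    ∑ k, c k * MvPolynomial.eval (x k) q = 0 := by
  simp_rw [MvPolynomial.eval_eq', mul_sum]
  rw [sum_comm]
  refine sum_eq_zero fun e he => ?_
  have hdeg : ∑ i, e i ≤ D := by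
    have := (MvPolynomial.le_totalDegree he).trans hq
    rwa [Finsupp.sum_fintype _ _ fun _ => rfl] at this
  obtain ⟨k, hk⟩ := exists_reducedExp (p := p) e hdeg
  have h1 := congrFun h k
  simp only [Finset.sum_apply, Pi.smul_apply, smul_eq_mul, Pi.zero_apply, hk] at h1
  calc _ = q.coeff e * ∑ j, c j * ∏ i, x j i ^ e i := by
        rw [mul_sum]; exact sum_congr rfl fun j _ => by ring
    _ = 0 := by rw [h1, mul_zero]

/-- Distinct reduced monomials are linearly independent as functions. -/
theorem linearIndependent_monomial (p : ℕ) [Fact p.Prime] (D r : ℕ) :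
    LinearIndependent (ZMod p)
      (fun (e : ReducedExp p D (Fin r)) (x : Fin r → ZMod p) => monoEval D x e) := by
  classical
  rw [Fintype.linearIndependent_iff]
  intro g hg e₀
  let toF : ReducedExp p D (Fin r) → (Fin r →₀ ℕ) := fun e =>
    Finsupp.equivFunOnFinite.symm fun i => (e.1 i : ℕ)
  have htoF : Function.Injective toF := by
    intro a b hab
    apply Subtype.ext
    funext i
    apply Fin.ext
    exact DFunLike.congr_fun hab i
  let q : MvPolynomial (Fin r) (ZMod p) := ∑ e, MvPolynomial.monomial (toF e) (g e)
  have hq : q = 0 := by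
    apply MvPolynomial.eq_zero_of_eval_eq_zero
    · intro v
      have h1 := congrFun hg v
      simp only [Finset.sum_apply, Pi.smul_apply, smul_eq_mul, Pi.zero_apply] at h1
      rw [← h1]
      simp only [q, map_sum, MvPolynomial.eval_monomial]
      refine sum_congr rfl fun e _ => ?_
      rw [Finsupp.prod_fintype _ _ (fun _ => pow_zero _)]
      rfl
    · rw [ZMod.card]
      refine Submodule.sum_mem _ fun e _ => ?_
      rw [MvPolynomial.mem_restrictDegree]
      intro s hs i
      have := MvPolynomial.support_monomial_subset hs
      rw [mem_singleton] at this
      subst this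
      have := (e.1 i).2
      change (e.1 i : ℕ) ≤ p - 1
      omega
  have h2 : q.coeff (toF e₀) = g e₀ := by
    simp only [q, MvPolynomial.coeff_sum, MvPolynomial.coeff_monomial]
    rw [sum_eq_single e₀]
    · simp
    · intro b _ hb
      rw [if_neg (fun h => hb (htoF h))]
    · simp
  rw [← h2, hq, MvPolynomial.coeff_zero]

/-- Some `|ReducedExp p D (Fin r)|` points have linearly independent evaluation vectors. -/
theorem exists_interpolation_set (p : ℕ) [Fact p.Prime] (D r : ℕ) :
    ∃ I : Finset (Fin r → ZMod p), #I = Fintype.card (ReducedExp p D (Fin r)) ∧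
      LinearIndependent (ZMod p) (fun y : I => monoEval D (y : Fin r → ZMod p)) := by
  classical
  let M : Matrix (ReducedExp p D (Fin r)) (Fin r → ZMod p) (ZMod p) :=
    Matrix.of fun e x => monoEval D x e
  have hrow : LinearIndependent (ZMod p) M.row := linearIndependent_monomial p D r
  -- Row rank equals column rank: the rows are the monomials as functions, the columns the
  -- evaluation vectors.
  have hrank := hrow.rank_matrix
  rw [Matrix.rank_eq_finrank_span_cols] at hrank
  obtain ⟨κ, a, ha, hspan, hli⟩ := exists_linearIndependent' (ZMod p) M.col
  have : Fintype κ := Fintype.ofInjective a ha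
  rw [← hspan, finrank_span_eq_card hli] at hrank
  refine ⟨univ.map ⟨a, ha⟩, by simpa using hrank, ?_⟩
  have hliOn := (linearIndepOn_range_iff ha M.col).2 hli
  have e : (↑(univ.map ⟨a, ha⟩) : Set (Fin r → ZMod p)) = Set.range a := by simp
  rw [← e] at hliOn
  exact hliOn

/-! ### Hashing by random affine maps. -/

/-- A matrix and a translation vector, the data of an affine map `F_p ^ N → F_p ^ r`. -/
abbrev AffineData (p N r : ℕ) : Type := (Fin r → Fin N → ZMod p) × (Fin r → ZMod p)

section Hashing

variable {p : ℕ} [Fact p.Prime] {N r : ℕ}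

/-- The affine map `x ↦ A x + c`. -/
def affineMap (π : AffineData p N r) (x : Fin N → ZMod p) :
    Fin r → ZMod p :=
  fun i => ∑ l, π.1 i l * x l + π.2 i

/-- For each matrix exactly one translation works. -/
theorem card_affine_eq (x : Fin N → ZMod p) (y : Fin r → ZMod p) :
    #{π : AffineData p N r | affineMap π x = y} * p ^ r =
      Fintype.card (AffineData p N r) := by
  have h : #{π : AffineData p N r | affineMap π x = y} =
      Fintype.card (Fin r → Fin N → ZMod p) := by
    rw [← card_univ]
    refine card_nbij' (fun π => π.1) (fun A => (A, fun i => y i - ∑ l, A i l * x l)) ?_ ?_ ?_ ?_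
    · simp
    · intro A _
      simp only [coe_filter, mem_univ, true_and, Set.mem_ofPred_eq]
      funext i
      simp [affineMap]
    · intro π hπ
      simp only [coe_filter, mem_univ, true_and, Set.mem_ofPred_eq] at hπ
      refine Prod.ext rfl ?_
      funext i
      simp [← hπ, affineMap]
    · intro A _; rfl
  rw [h, Fintype.card_prod]
  simp [ZMod.card]

/-- Half of pairwise independence. In a coordinate `l` where the points differ, shift column `l` of
the matrix by `u` and the translation by `w`. The images of the two points under the shifted matrix
determine `u`, then the original translation, `w` and the matrix, so the shifts are injective. -/
theorem card_affine_eq_eq_le {x x' : Fin N → ZMod p} (hx : x ≠ x') (y : Fin r → ZMod p) :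
    #{π : AffineData p N r | affineMap π x = y ∧ affineMap π x' = y}
        * (p ^ r * p ^ r) ≤
      Fintype.card (AffineData p N r) := by
  classical
  obtain ⟨l, hl⟩ := Function.ne_iff.1 hx
  have hl' : x l - x' l ≠ 0 := sub_ne_zero.2 hl
  have hc : Fintype.card ((Fin r → ZMod p) × (Fin r → ZMod p)) = p ^ r * p ^ r := by
    simp [ZMod.card]
  rw [← hc, ← card_univ, ← card_univ, ← card_product]
  refine card_le_card_of_injOn
    (fun q => ((fun i => Function.update (q.1.1 i) l (q.1.1 i l + q.2.1 i)),
      fun i => q.1.2 i + q.2.2 i)) (fun _ _ => mem_coe.2 (mem_univ _)) ?_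
  have hupd : ∀ (a z : Fin N → ZMod p) (u : ZMod p),
      ∑ k, Function.update a l (a l + u) k * z k = ∑ k, a k * z k + u * z l := by
    intro a z u
    have : ∀ k, Function.update a l (a l + u) k * z k = a k * z k + if k = l then u * z l else 0 := by
      intro k
      by_cases hk : k = l
      · subst hk; simp; ring
      · simp [hk]
    simp [this, sum_add_distrib]
  rintro ⟨⟨A, c⟩, u, w⟩ h ⟨⟨B, d⟩, v, s⟩ h' heq
  simp only [coe_product, coe_filter, mem_univ, true_and, Set.mem_prod, Set.mem_ofPred_eq,
    coe_univ, Set.mem_univ, and_true] at h h'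
  simp only [Prod.mk.injEq] at heq
  obtain ⟨h1, h2⟩ := heq
  have hA : ∀ i, ∑ k, A i k * x k = y i - c i ∧ ∑ k, A i k * x' k = y i - c i := fun i =>
    ⟨eq_sub_of_add_eq (congrFun h.1 i), eq_sub_of_add_eq (congrFun h.2 i)⟩
  have hB : ∀ i, ∑ k, B i k * x k = y i - d i ∧ ∑ k, B i k * x' k = y i - d i := fun i =>
    ⟨eq_sub_of_add_eq (congrFun h'.1 i), eq_sub_of_add_eq (congrFun h'.2 i)⟩
  have key : ∀ i, u i = v i ∧ c i = d i := by
    intro i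
    have e1 := congrArg (fun a : Fin N → ZMod p => ∑ k, a k * x k) (congrFun h1 i)
    have e2 := congrArg (fun a : Fin N → ZMod p => ∑ k, a k * x' k) (congrFun h1 i)
    simp only [hupd, (hA i).1, (hB i).1, (hA i).2, (hB i).2] at e1 e2
    have huv : u i = v i := by
      apply mul_right_cancel₀ hl'
      linear_combination e1 - e2
    refine ⟨huv, ?_⟩
    rw [huv] at e1
    linear_combination -e1
  have hu : u = v := funext fun i => (key i).1
  have hcd : c = d := funext fun i => (key i).2
  subst hu hcd
  have hws : w = s := by
    funext i
    simpa using congrFun h2 i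
  subst hws
  have hAB : A = B := by
    funext i k
    have e := congrFun (congrFun h1 i) k
    by_cases hk : k = l
    · subst hk; simpa using e
    · simpa [hk] using e
  rw [hAB]

/-- A random affine map sends a set of `p ^ r` points onto a given point with probability at
least one half. -/
theorem card_le_two_mul_card_hit (S : Finset (Fin N → ZMod p)) (hS : #S = p ^ r)
    (y : Fin r → ZMod p) :
    Fintype.card (AffineData p N r) ≤
      2 * #{π : AffineData p N r | ∃ s ∈ S, affineMap π s = y} := by
  classical
  set P := Fintype.card (AffineData p N r)
  have hp0 : 0 < p ^ r := pow_pos (Fact.out : p.Prime).pos r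
  let c : AffineData p N r → ℕ := fun π => #{s ∈ S | affineMap π s = y}
  -- This is `(c - 1) * (c - 2) ≥ 0` when `c ≠ 0`. Summed with `∑ c = P` and `∑ c ^ 2 ≤ 2 * P`, it
  -- gives the claim.
  have hpt : ∀ π : AffineData p N r, 3 * c π ≤
      2 * (if ∃ s ∈ S, affineMap π s = y then 1 else 0) + c π * c π := by
    intro π
    split_ifs with h
    · have : (0 : ℤ) ≤ ((c π : ℤ) - 1) * ((c π : ℤ) - 2) := by
        rcases le_or_gt (c π) 1 with h1 | h1
        · nlinarith [(by exact_mod_cast h1 : (c π : ℤ) ≤ 1)]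
        · nlinarith [(by exact_mod_cast h1 : (1 : ℤ) < c π)]
      zify
      nlinarith
    · have : c π = 0 := by
        simp only [c, card_eq_zero, filter_eq_empty_iff]
        exact fun s hs hsy => h ⟨s, hs, hsy⟩
      simp [this]
  have hsum := sum_le_sum fun π (_ : π ∈ (univ : Finset (AffineData p N r))) => hpt π
  rw [sum_add_distrib, ← mul_sum, ← mul_sum, ← card_filter] at hsum
  have hfirst : ∑ π, c π = P := by
    have : ∑ π, c π = ∑ s ∈ S, #{π : AffineData p N r | affineMap π s = y} := by
      simp only [c, card_filter]
      rw [sum_comm]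
    apply Nat.eq_of_mul_eq_mul_right hp0
    rw [this, sum_mul, sum_congr rfl fun s _ => card_affine_eq s y, sum_const, hS, smul_eq_mul,
      mul_comm]
  have hsecond : ∑ π, c π * c π ≤ 2 * P := by
    have h1 : ∑ π, c π * c π =
        ∑ s ∈ S, ∑ s' ∈ S, #{π : AffineData p N r | affineMap π s = y ∧ affineMap π s' = y} := by
      simp only [c, card_filter, sum_mul_sum]
      rw [sum_comm]
      refine sum_congr rfl fun s _ => ?_
      rw [sum_comm]
      refine sum_congr rfl fun s' _ => sum_congr rfl fun π _ => ?_
      by_cases h1 : affineMap π s = y <;> by_cases h2 : affineMap π s' = y <;> simp [h1, h2]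
    have h2 : ∀ s ∈ S, (∑ s' ∈ S, #{π : AffineData p N r | affineMap π s = y ∧ affineMap π s' = y}) * p ^ r ≤
        2 * P := by
      intro s hs
      rw [← add_sum_erase _ _ hs]
      have h3 : (∑ s' ∈ S.erase s, #{π : AffineData p N r | affineMap π s = y ∧ affineMap π s' = y}) * p ^ r
          ≤ P := by
        apply Nat.le_of_mul_le_mul_right _ hp0
        rw [mul_assoc, sum_mul]
        refine (sum_le_card_nsmul _ _ P fun s' hs' =>
          card_affine_eq_eq_le (ne_of_mem_erase hs').symm y).trans ?_
        rw [smul_eq_mul, mul_comm]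
        exact Nat.mul_le_mul_left _ ((card_le_card (erase_subset _ _)).trans hS.le)
      have h4 := card_affine_eq (r := r) s y
      simp only [and_self]
      rw [add_mul, h4]
      change P + _ ≤ _
      omega
    rw [h1]
    apply Nat.le_of_mul_le_mul_right _ hp0
    rw [sum_mul]
    refine (sum_le_card_nsmul _ _ _ h2).trans ?_
    rw [hS, smul_eq_mul, mul_comm]
  rw [hfirst] at hsum
  omega

end Hashing

/-- Pulling back along an affine map does not raise the degree. -/
theorem monoEval_affine {p : ℕ} [Fact p.Prime] {N r D : ℕ}
    (π : AffineData p N r) (e : ReducedExp p D (Fin r)) :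
    ∃ q : MvPolynomial (Fin N) (ZMod p), q.totalDegree ≤ D ∧
      ∀ x, MvPolynomial.eval x q = monoEval D (affineMap π x) e := by
  refine ⟨∏ i, (∑ l, MvPolynomial.C (π.1 i l) * MvPolynomial.X l + MvPolynomial.C (π.2 i)) ^
    (e.1 i : ℕ), ?_, ?_⟩
  · refine (MvPolynomial.totalDegree_finsetProd _ _).trans (le_trans ?_ e.2)
    refine sum_le_sum fun i _ => (MvPolynomial.totalDegree_pow _ _).trans ?_
    refine (Nat.mul_le_mul_left _ ?_).trans (mul_one _).le
    refine (MvPolynomial.totalDegree_add _ _).trans (max_le ?_ (by simp))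
    refine MvPolynomial.totalDegree_finsetSum_le fun l _ =>
      (MvPolynomial.totalDegree_mul _ _).trans ?_
    simp
  · intro x
    simp [monoEval, affineMap]

/-- A subspace of less than half the dimension of the space of polynomials of degree `≤ D` in `r`
variables contains fewer than `p ^ r` evaluation vectors. -/
theorem card_monoEval_mem_lt {p : ℕ} [Fact p.Prime] {N r D : ℕ}
    (W : Submodule (ZMod p) (ReducedExp p D (Fin N) → ZMod p))
    (hW : 2 * finrank (ZMod p) W < Fintype.card (ReducedExp p D (Fin r))) :
    {b : Fin N → ZMod p | monoEval D b ∈ W}.ncard < p ^ r := by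
  classical
  by_contra! hcon
  rw [Set.ncard_eq_toFinset_card'] at hcon
  obtain ⟨S, hSW, hS⟩ := exists_subset_card_eq hcon
  obtain ⟨I, hI, hli⟩ := exists_interpolation_set p D r
  -- Averaging over the affine maps: one of them hits at least half of `I`.
  obtain ⟨π, hπ⟩ : ∃ π : AffineData p N r, #I ≤ 2 * #{y ∈ I | ∃ s ∈ S, affineMap π s = y} := by
    by_contra! h
    have h1 : ∑ π : AffineData p N r, 2 * #{y ∈ I | ∃ s ∈ S, affineMap π s = y} < ∑ π : AffineData p N r, #I :=
      sum_lt_sum_of_nonempty univ_nonempty fun π _ => h π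
    have h2 := sum_le_sum fun y (_ : y ∈ I) => card_le_two_mul_card_hit S hS y
    rw [← mul_sum, sum_const] at h1 h2
    have h3 : ∑ π : AffineData p N r, #{y ∈ I | ∃ s ∈ S, affineMap π s = y} =
        ∑ y ∈ I, #{π : AffineData p N r | ∃ s ∈ S, affineMap π s = y} := by
      simp only [card_filter]
      rw [sum_comm]
    rw [h3, card_univ, smul_eq_mul] at h1
    rw [smul_eq_mul, mul_comm] at h2
    exact absurd h1 (not_lt.2 h2)
  set Y := {y ∈ I | ∃ s ∈ S, affineMap π s = y}
  choose s hsS hsy using fun y : Y => (mem_filter.1 y.2).2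
  have hind : LinearIndependent (ZMod p) fun y : Y => monoEval D (s y) := by
    rw [Fintype.linearIndependent_iff]
    intro g hg
    have hli' : LinearIndependent (ZMod p) fun y : Y => monoEval D (y : Fin r → ZMod p) :=
      hli.comp (fun y : Y => (⟨y.1, (mem_filter.1 y.2).1⟩ : I)) fun a b h => by
        apply Subtype.ext
        simpa using h
    refine Fintype.linearIndependent_iff.1 hli' g ?_
    funext e
    -- A relation among the preimages holds for all polynomials of degree at most `D`, in particular
    -- for pullbacks, so it descends to the points of `Y`.
    obtain ⟨q, hq, hqe⟩ := monoEval_affine π e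
    have := sum_eval_eq_zero s g hg q hq
    simp only [hqe, hsy] at this
    simpa using this
  have hmem : ∀ y : Y, monoEval D (s y) ∈ W := fun y => by
    simpa using hSW (hsS y)
  have hindW : LinearIndependent (ZMod p) fun y : Y => (⟨monoEval D (s y), hmem y⟩ : W) :=
    LinearIndependent.of_comp W.subtype hind
  have := hindW.fintype_card_le_finrank
  rw [Fintype.card_coe] at this
  omega

end RMBias

/-! ### Tuples of low rank and linear relations. -/

namespace RMBias

open Finset Module

/-- If, outside of a set `I` of indices, every coordinate of `b` lies in a set of size at most `M`
determined by the coordinates in `I`, then `b` is one of few. -/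
theorem card_pi_dependent_le {κ V : Type*} [Fintype κ] [DecidableEq κ] [Fintype V] [DecidableEq V]
    (I : Finset κ) (S : (I → V) → Finset V) (M : ℕ) (hS : ∀ c, #(S c) ≤ M) :
    #{b : κ → V | ∀ k, k ∉ I → b k ∈ S fun i : I => b i} ≤
      Fintype.card V ^ #I * M ^ (Fintype.card κ - #I) := by
  classical
  let target : Finset (Σ _ : I → V, ({k // k ∉ I} → V)) :=
    univ.sigma fun c => Fintype.piFinset fun _ => S c
  have h1 : #{b : κ → V | ∀ k, k ∉ I → b k ∈ S fun i : I => b i} ≤ #target := by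
    refine card_le_card_of_injOn (fun b => ⟨fun i => b i, fun k => b k⟩) ?_ ?_
    · intro b hb
      simp only [coe_filter, mem_univ, true_and, Set.mem_ofPred_eq] at hb
      simp only [target, coe_sigma, Set.mem_sigma_iff, coe_univ, Set.mem_univ, true_and, mem_coe,
        Fintype.mem_piFinset]
      exact fun k => hb k k.2
    · intro b _ b' _ h
      simp only [Sigma.mk.injEq, heq_eq_eq] at h
      funext k
      by_cases hk : k ∈ I
      · exact congrFun h.1 ⟨k, hk⟩
      · exact congrFun h.2 ⟨k, hk⟩
  refine h1.trans ?_
  rw [card_sigma]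
  refine (sum_le_card_nsmul _ _ (M ^ (Fintype.card κ - #I)) fun c _ => ?_).trans ?_
  · rw [Fintype.card_piFinset, prod_const, card_univ]
    have : Fintype.card {k // k ∉ I} = Fintype.card κ - #I := by
      rw [Fintype.card_subtype_compl, Fintype.card_coe]
    rw [this]
    exact Nat.pow_le_pow_left (hS c) _
  · rw [card_univ, Fintype.card_fun, Fintype.card_coe, smul_eq_mul]

section Rank

variable {p : ℕ} [Fact p.Prime] {κ : Type*} [Fintype κ] {N r D R : ℕ}

/-- Some `R` of the points `b k` have linearly independent evaluation vectors. -/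
def HasRank (p D R : ℕ) {N : ℕ} (b : κ → Fin N → ZMod p) : Prop :=
  ∃ I : Finset κ, #I = R ∧ LinearIndependent (ZMod p) fun k : I => monoEval D (b k)

theorem exists_spanning_of_not_hasRank {b : κ → Fin N → ZMod p} (hb : ¬ HasRank p D R b) :
    ∃ I : Finset κ, #I < R ∧
      ∀ k, monoEval D (b k) ∈
        Submodule.span (ZMod p) (Set.range fun i : I => monoEval D (b i)) := by
  classical
  obtain ⟨ι, a, ha, hspan, hli⟩ := exists_linearIndependent' (ZMod p) fun k => monoEval D (b k)
  have : Fintype ι := Fintype.ofInjective a ha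
  have hrange : (↑(univ.map ⟨a, ha⟩) : Set κ) = Set.range a := by simp
  have hli' : LinearIndepOn (ZMod p) (fun k => monoEval D (b k)) (↑(univ.map ⟨a, ha⟩) : Set κ) := by
    rw [hrange]
    exact (linearIndepOn_range_iff ha _).2 hli
  refine ⟨univ.map ⟨a, ha⟩, ?_, fun k => ?_⟩
  · by_contra! h
    obtain ⟨J, hJ, hJR⟩ := exists_subset_card_eq h
    exact hb ⟨J, hJR, hli'.mono (coe_subset.2 hJ)⟩
  · have h1 : monoEval D (b k) ∈
        Submodule.span (ZMod p) (Set.range fun k => monoEval D (b k)) :=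
      Submodule.subset_span ⟨k, rfl⟩
    rw [← hspan] at h1
    refine Submodule.span_mono ?_ h1
    rintro _ ⟨i, rfl⟩
    exact ⟨⟨a i, by simp⟩, rfl⟩

open Classical in
/-- Few tuples of points have small rank. -/
theorem card_not_hasRank_le [DecidableEq κ] (hR : 2 * (R - 1) < Fintype.card (ReducedExp p D (Fin r)))
    (hrN : r ≤ N) (hRT : R ≤ Fintype.card κ) :
    #{b : κ → Fin N → ZMod p | ¬ HasRank p D R b} ≤
      2 ^ Fintype.card κ * p ^ (N * R + r * (Fintype.card κ - R)) := by
  have hp : 0 < p := (Fact.out : p.Prime).pos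
  let W : (I : Finset κ) → (I → Fin N → ZMod p) →
      Submodule (ZMod p) (ReducedExp p D (Fin N) → ZMod p) := fun I c =>
    Submodule.span (ZMod p) (Set.range fun i => monoEval D (c i))
  let B : Finset κ → Finset (κ → Fin N → ZMod p) := fun I =>
    {b | ∀ k, k ∉ I → b k ∈ ({x | monoEval D x ∈ W I fun i => b i} : Finset (Fin N → ZMod p))}
  have hsub : ({b : κ → Fin N → ZMod p | ¬ HasRank p D R b} : Finset _) ⊆
      ({I | #I < R} : Finset (Finset κ)).biUnion B := by
    intro b hb
    obtain ⟨I, hI, hspan⟩ := exists_spanning_of_not_hasRank (mem_filter.1 hb).2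
    simp only [mem_biUnion, mem_filter, mem_univ, true_and, B]
    exact ⟨I, hI, fun k _ => hspan k⟩
  have hB : ∀ I ∈ ({I | #I < R} : Finset (Finset κ)),
      #(B I) ≤ p ^ (N * R + r * (Fintype.card κ - R)) := by
    intro I hI
    have hI : #I < R := (mem_filter.1 hI).2
    have h1 := card_pi_dependent_le I
      (fun c => ({x | monoEval D x ∈ W I c} : Finset (Fin N → ZMod p))) (p ^ r) fun c => by
        have hfin : finrank (ZMod p) (W I c) ≤ #I := by
          exact (finrank_range_le_card (R := ZMod p) fun i => monoEval D (c i)).trans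
            (Fintype.card_coe I).le
        have := card_monoEval_mem_lt (r := r) (W I c) (by omega)
        rw [Set.ncard_eq_toFinset_card'] at this
        simpa using this.le
    refine h1.trans ?_
    rw [Fintype.card_fun, ZMod.card, Fintype.card_fin, ← pow_mul, ← pow_mul, ← pow_add]
    apply Nat.pow_le_pow_right hp
    obtain ⟨u, rfl⟩ := Nat.exists_eq_add_of_lt hI
    obtain ⟨v, hv⟩ := Nat.exists_eq_add_of_le hRT
    have e1 : Fintype.card κ - #I = u + 1 + v := by omega
    have e2 : Fintype.card κ - (#I + u + 1) = v := by omega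
    rw [e1, e2]
    -- As `r ≤ N`, the exponent increases with `#I`, so `#I = R` bounds all cases.
    nlinarith [Nat.mul_le_mul_right (u + 1) hrN]
  refine (card_le_card hsub).trans (card_biUnion_le.trans ?_)
  refine (sum_le_card_nsmul _ _ _ hB).trans ?_
  rw [smul_eq_mul]
  refine Nat.mul_le_mul_right _ ((card_filter_le _ _).trans ?_)
  rw [card_univ, Fintype.card_finset]

open Classical in
/-- Linear relations among a tuple of points of large rank. -/
theorem card_relations_le [DecidableEq κ] {b : κ → Fin N → ZMod p} (hb : HasRank p D R b) (ε : κ → ZMod p)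
    (hε : ∀ k, ε k ≠ 0) :
    #{α : κ → ZMod p | ∑ k, (ε k * α k) • monoEval D (b k) = 0} ≤ p ^ (Fintype.card κ - R) := by
  obtain ⟨I, hI, hli⟩ := hb
  have hc : Fintype.card ({k // k ∉ I} → ZMod p) = p ^ (Fintype.card κ - R) := by
    rw [Fintype.card_fun, ZMod.card, Fintype.card_subtype_compl, Fintype.card_coe, hI]
  rw [← hc, ← card_univ]
  refine card_le_card_of_injOn (fun α k => α k) (fun _ _ => mem_coe.2 (mem_univ _)) ?_
  intro α hα β hβ h
  simp only [coe_filter, mem_univ, true_and, Set.mem_ofPred_eq] at hα hβ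
  have hoff : ∀ k, k ∉ I → α k = β k := fun k hk => congrFun h ⟨k, hk⟩
  -- Relations agreeing off `I` differ by a relation supported on the independent set `I`.
  have hsum : ∑ k, (ε k * (α k - β k)) • monoEval D (b k) = 0 := by
    simp only [mul_sub, sub_smul, sum_sub_distrib, hα, hβ, sub_self]
  have hsumI : ∑ k : I, (ε k * (α k - β k)) • monoEval D (b k) = 0 := by
    rw [sum_coe_sort I fun k => (ε k * (α k - β k)) • monoEval D (b k), ← hsum]
    refine sum_subset (subset_univ I) fun k _ hk => ?_
    rw [hoff k hk, sub_self, mul_zero, zero_smul]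
  have hzero := Fintype.linearIndependent_iff.1 hli _ hsumI
  funext k
  by_cases hk : k ∈ I
  · have := hzero ⟨k, hk⟩
    simpa [hε k, sub_eq_zero] using this
  · exact hoff k hk

-- For fixed `b` the `m` relations are chosen independently, which gives an `m`-th power. The first
-- summand bounds the `b` of rank `R`; the second takes the few others with all coefficients
-- allowed.
open Classical in
theorem card_tensor_relations_le [DecidableEq κ] (m : ℕ)
    (hR : 2 * (R - 1) < Fintype.card (ReducedExp p D (Fin r)))
    (hrN : r ≤ N) (hRT : R ≤ Fintype.card κ) (ε : κ → ZMod p) (hε : ∀ k, ε k ≠ 0) :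
    #{q : (Fin m → κ → ZMod p) × (κ → Fin N → ZMod p) |
        ∀ i, ∑ k, (ε k * q.1 i k) • monoEval D (q.2 k) = 0} ≤
      p ^ (N * Fintype.card κ) * p ^ ((Fintype.card κ - R) * m) +
        2 ^ Fintype.card κ * p ^ (N * R + r * (Fintype.card κ - R)) * p ^ (Fintype.card κ * m) := by
  have hfib : #{q : (Fin m → κ → ZMod p) × (κ → Fin N → ZMod p) |
      ∀ i, ∑ k, (ε k * q.1 i k) • monoEval D (q.2 k) = 0} =
      ∑ b : κ → Fin N → ZMod p,
        #{α : κ → ZMod p | ∑ k, (ε k * α k) • monoEval D (b k) = 0} ^ m := by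
    have : ({q : (Fin m → κ → ZMod p) × (κ → Fin N → ZMod p) |
        ∀ i, ∑ k, (ε k * q.1 i k) • monoEval D (q.2 k) = 0} : Finset _) =
        (univ : Finset (κ → Fin N → ZMod p)).biUnion fun b =>
          (Fintype.piFinset fun _ : Fin m =>
            ({α : κ → ZMod p | ∑ k, (ε k * α k) • monoEval D (b k) = 0} : Finset _)) ×ˢ {b} := by
      ext ⟨a, b⟩
      simp [Fintype.mem_piFinset]
    rw [this, card_biUnion]
    · simp
    · intro b _ b' _ hbb'
      rw [Function.onFun, disjoint_left]
      rintro ⟨a, c⟩ h h'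
      simp only [mem_product, mem_singleton] at h h'
      exact hbb' (h.2.symm.trans h'.2)
  rw [hfib, ← sum_filter_add_sum_filter_not univ fun b => HasRank p D R b]
  refine add_le_add ?_ ?_
  · refine (sum_le_card_nsmul _ _ (p ^ ((Fintype.card κ - R) * m)) fun b hb => ?_).trans ?_
    · rw [pow_mul]
      exact Nat.pow_le_pow_left (card_relations_le (mem_filter.1 hb).2 ε hε) m
    · rw [smul_eq_mul]
      refine Nat.mul_le_mul_right _ ((card_filter_le _ _).trans ?_)
      simp [ZMod.card, ← pow_mul]
  · refine (sum_le_card_nsmul _ _ (p ^ (Fintype.card κ * m)) fun b hb => ?_).trans ?_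
    · rw [pow_mul]
      refine Nat.pow_le_pow_left ((card_filter_le _ _).trans ?_) m
      simp [ZMod.card]
    · rw [smul_eq_mul]
      exact Nat.mul_le_mul_right _ (card_not_hasRank_le hR hrN hRT)

end Rank

end RMBias

/-! ### Moments of the bias. -/

namespace RMBias

open Finset Module ComplexConjugate

variable {p : ℕ} [Fact p.Prime]

theorem add_mem_polys {d n : ℕ} {f g : MvPolynomial (Fin n) (ZMod p)} (hf : f ∈ polys p d n)
    (hg : g ∈ polys p d n) : f + g ∈ polys p d n := by
  classical
  rw [mem_polys_iff (NeZero.pos p)] at hf hg ⊢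
  intro e he
  rcases mem_union.1 (MvPolynomial.support_add he) with h | h
  exacts [hf e h, hg e h]

theorem neg_mem_polys {d n : ℕ} {f : MvPolynomial (Fin n) (ZMod p)} (hf : f ∈ polys p d n) :
    -f ∈ polys p d n := by
  rw [mem_polys_iff (NeZero.pos p)] at hf ⊢
  rwa [MvPolynomial.support_neg]

open Classical in
/-- Orthogonality of characters on the group of polynomials of degree at most `d`. -/
theorem norm_sum_stdAddChar_le {d n : ℕ} (j : ZMod p) (hj : j ≠ 0)
    (L : MvPolynomial (Fin n) (ZMod p) →+ ZMod p) :
    ‖∑ f ∈ (polys_finite p d n).toFinset, ZMod.stdAddChar (j * L f)‖ ≤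
      if ∀ f ∈ polys p d n, L f = 0 then (#(polys_finite p d n).toFinset : ℝ) else 0 := by
  split_ifs with h
  · refine (norm_sum_le _ _).trans ?_
    simp
  · push Not at h
    obtain ⟨g, hg, hLg⟩ := h
    set s := ∑ f ∈ (polys_finite p d n).toFinset, ZMod.stdAddChar (j * L f) with hs
    -- Translating the sum by `g` multiplies it by a root of unity other than `1`.
    have hshift : s = ZMod.stdAddChar (j * L g) * s := by
      rw [hs, mul_sum]
      symm
      refine sum_nbij' (fun f => f + g) (fun f => f + -g) ?_ ?_ ?_ ?_ ?_
      · intro f hf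
        rw [Set.Finite.mem_toFinset] at hf ⊢
        exact add_mem_polys hf hg
      · intro f hf
        rw [Set.Finite.mem_toFinset] at hf ⊢
        exact add_mem_polys hf (neg_mem_polys hg)
      · intro f _; simp
      · intro f _; simp
      · intro f _
        rw [map_add, mul_add, AddChar.map_add_eq_mul, mul_comm]
    have hne : ZMod.stdAddChar (j * L g) ≠ (1 : ℂ) := by
      intro h1
      rw [← AddChar.map_zero_eq_one (ZMod.stdAddChar (N := p))] at h1
      exact mul_ne_zero hj hLg (ZMod.injective_stdAddChar h1)
    have : s = 0 := by
      have h2 : (ZMod.stdAddChar (j * L g) - 1) * s = 0 := by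
        rw [sub_mul, one_mul, ← hshift, sub_self]
      exact (mul_eq_zero.1 h2).resolve_left (sub_ne_zero.2 hne)
    rw [this, norm_zero]

/-- Signs: `t` copies of `1` followed by `t` copies of `-1`. -/
def signs (p t : ℕ) : Fin t ⊕ Fin t → ZMod p := Sum.elim (fun _ => 1) fun _ => -1

theorem signs_ne_zero (t : ℕ) (k : Fin t ⊕ Fin t) : signs p t k ≠ 0 := by
  rcases k with k | k <;> simp [signs]

/-- Expand `S ^ t * conj S ^ t`; the negative signs produce the conjugates. -/
theorem ofReal_norm_pow_eq {n : ℕ} (t : ℕ) (j : ZMod p) (f : (Fin n → ZMod p) → ZMod p) :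
    ((‖∑ x, (ZMod.stdAddChar (j * f x) : ℂ)‖ ^ (t + t) : ℝ) : ℂ) =
      ∑ x : Fin t ⊕ Fin t → Fin n → ZMod p,
        ZMod.stdAddChar (j * ∑ k, signs p t k * f (x k)) := by
  have h1 : ∀ x : Fin t ⊕ Fin t → Fin n → ZMod p,
      (ZMod.stdAddChar (j * ∑ k, signs p t k * f (x k)) : ℂ) =
        ∏ k, ZMod.stdAddChar (j * (signs p t k * f (x k))) := by
    intro x
    rw [mul_sum]
    exact map_prod (ZMod.stdAddChar (N := p)).toMonoidHom
      (fun k => Multiplicative.ofAdd (j * (signs p t k * f (x k)))) univ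
  simp_rw [h1]
  rw [← Fintype.prod_sum fun (k : Fin t ⊕ Fin t) (y : Fin n → ZMod p) =>
    (ZMod.stdAddChar (j * (signs p t k * f y)) : ℂ), Fintype.prod_sum_type]
  simp only [signs, Sum.elim_inl, Sum.elim_inr, one_mul, neg_mul, mul_neg, prod_const, card_univ,
    Fintype.card_fin, AddChar.map_neg_eq_conj]
  rw [← map_sum (starRingEnd ℂ), ← mul_pow, Complex.mul_conj', ← two_mul, pow_mul]
  push_cast
  rfl

open Classical in
/-- The moments of the bias count tuples of points annihilating all polynomials. -/
theorem sum_norm_pow_le {d n : ℕ} (t : ℕ) (j : ZMod p) (hj : j ≠ 0) :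
    ∑ f ∈ (polys_finite p d n).toFinset,
        ‖∑ x, (ZMod.stdAddChar (j * MvPolynomial.eval x f) : ℂ)‖ ^ (t + t) ≤
      (#(polys_finite p d n).toFinset : ℝ) *
        #{x : Fin t ⊕ Fin t → Fin n → ZMod p |
          ∀ f ∈ polys p d n, ∑ k, signs p t k * MvPolynomial.eval (x k) f = 0} := by
  set P := (polys_finite p d n).toFinset
  let L : (Fin t ⊕ Fin t → Fin n → ZMod p) → MvPolynomial (Fin n) (ZMod p) →+ ZMod p := fun x =>
    ∑ k, (AddMonoidHom.mulLeft (signs p t k)).comp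
      (MvPolynomial.eval (x k) : MvPolynomial (Fin n) (ZMod p) →+* ZMod p).toAddMonoidHom
  have hL : ∀ x f, L x f = ∑ k, signs p t k * MvPolynomial.eval (x k) f := by
    intro x f
    simp [L]
  have hswap : ((∑ f ∈ P, ‖∑ x, (ZMod.stdAddChar (j * MvPolynomial.eval x f) : ℂ)‖ ^ (t + t) : ℝ)
      : ℂ) = ∑ x, ∑ f ∈ P, ZMod.stdAddChar (j * L x f) := by
    rw [Complex.ofReal_sum, sum_comm]
    refine sum_congr rfl fun f _ => ?_
    rw [ofReal_norm_pow_eq t j fun x => MvPolynomial.eval x f]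
    simp_rw [hL]
  have hnn : 0 ≤ ∑ f ∈ P, ‖∑ x, (ZMod.stdAddChar (j * MvPolynomial.eval x f) : ℂ)‖ ^ (t + t) :=
    sum_nonneg fun _ _ => by positivity
  rw [← Complex.norm_of_nonneg hnn, hswap]
  refine (norm_sum_le _ _).trans ((sum_le_sum fun x _ => norm_sum_stdAddChar_le j hj (L x)).trans ?_)
  simp_rw [hL]
  rw [← sum_filter, sum_const, nsmul_eq_mul, mul_comm]

open Classical in
/-- Only products of a variable among the first `m` and a monomial in the remaining `N` variables
are kept as tests. -/
theorem card_annihilating_le (m N D : ℕ) {κ : Type*} [Fintype κ] [DecidableEq κ] (ε : κ → ZMod p) :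
    #{x : κ → Fin (m + N) → ZMod p |
        ∀ f ∈ polys p (D + 1) (m + N), ∑ k, ε k * MvPolynomial.eval (x k) f = 0} ≤
      #{q : (Fin m → κ → ZMod p) × (κ → Fin N → ZMod p) |
        ∀ i, ∑ k, (ε k * q.1 i k) • monoEval D (q.2 k) = 0} := by
  refine card_le_card_of_injOn
    (fun x => (fun i k => x k (Fin.castAdd N i), fun k l => x k (Fin.natAdd m l))) ?_ ?_
  · intro x hx
    simp only [coe_filter, mem_univ, true_and, Set.mem_ofPred_eq] at hx ⊢
    intro i
    funext e
    -- The two blocks of variables are disjoint, so the product is again a reduced monomial.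
    let v : Fin (m + N) → ℕ := Fin.append (Pi.single i 1) fun l => (e.1 l : ℕ)
    have hmem : MvPolynomial.monomial (Finsupp.equivFunOnFinite.symm v) (1 : ZMod p) ∈
        polys p (D + 1) (m + N) := by
      rw [mem_polys_iff (NeZero.pos p)]
      intro w hw
      obtain rfl := mem_singleton.1 (MvPolynomial.support_monomial_subset hw)
      refine ⟨fun l => ?_, ?_⟩
      · change v l < p
        refine Fin.addCases (fun l => ?_) (fun l => ?_) l
        · simp only [v, Fin.append_left, Pi.single_apply]
          have := (Fact.out : p.Prime).one_lt
          split_ifs <;> omega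
        · simp only [v, Fin.append_right]
          exact (e.1 l).2
      · change ∑ l, v l ≤ D + 1
        rw [Fin.sum_univ_add]
        simp only [v, Fin.append_left, Fin.append_right, sum_pi_single', mem_univ, if_true]
        have := e.2
        omega
    have h := hx _ hmem
    simp only [MvPolynomial.eval_monomial, one_mul] at h
    simp only [Finset.sum_apply, Pi.smul_apply, smul_eq_mul, Pi.zero_apply]
    rw [← h]
    refine sum_congr rfl fun k _ => ?_
    rw [Finsupp.prod_fintype _ _ fun _ => pow_zero _, mul_assoc]
    congr 1
    change _ = ∏ l, x k l ^ v l
    rw [Fin.prod_univ_add]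
    simp only [v, Fin.append_left, Fin.append_right, monoEval]
    congr 1
    rw [prod_eq_single i] <;> simp +contextual
  · intro x _ y _ h
    simp only [Prod.mk.injEq] at h
    funext k l
    refine Fin.addCases (fun l => ?_) (fun l => ?_) l
    · exact congrFun (congrFun h.1 l) k
    · exact congrFun (congrFun h.2 k) l

end RMBias

/-! ### Counting reduced monomials. -/

namespace RMBias

open Finset Module

theorem card_reducedExp (p D n : ℕ) :
    Fintype.card (ReducedExp p D (Fin n)) = (monomials p D n).ncard := by
  rw [← Nat.card_eq_fintype_card, ← Nat.card_coe_set_eq]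
  exact Nat.card_congr
    { toFun := fun e => ⟨Finsupp.equivFunOnFinite.symm fun i => (e.1 i : ℕ),
        fun i => (e.1 i).2, e.2⟩
      invFun := fun e => ⟨fun i => ⟨e.1 i, e.2.1 i⟩, e.2.2⟩
      left_inv := fun _ => rfl
      right_inv := fun e => Subtype.ext (Finsupp.ext fun _ => rfl) }

theorem card_reducedExp_pos (p D n : ℕ) [NeZero p] :
    0 < Fintype.card (ReducedExp p D (Fin n)) :=
  Fintype.card_pos_iff.2 ⟨⟨fun _ => 0, by simp⟩⟩

/-- Summing an exponent over all reduced exponent vectors: by symmetry, the average of one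
exponent is at most `D / n`. -/
theorem mul_sum_exponent_le (p D n : ℕ) (i : Fin n) :
    n * ∑ e : ReducedExp p D (Fin n), (e.1 i : ℕ) ≤
      D * Fintype.card (ReducedExp p D (Fin n)) := by
  have hsymm : ∀ i', ∑ e : ReducedExp p D (Fin n), (e.1 i' : ℕ) =
      ∑ e : ReducedExp p D (Fin n), (e.1 i : ℕ) := by
    intro i'
    let σ : ReducedExp p D (Fin n) → ReducedExp p D (Fin n) := fun e =>
      ⟨fun l => e.1 (Equiv.swap i i' l), by
        rw [Equiv.sum_comp (Equiv.swap i i') fun l => (e.1 l : ℕ)]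
        exact e.2⟩
    have hσ : Function.Involutive σ := fun e => by
      apply Subtype.ext
      funext l
      simp [σ]
    rw [← Equiv.sum_comp hσ.toPerm fun e => (e.1 i : ℕ)]
    refine sum_congr rfl fun e _ => ?_
    simp [σ]
  calc n * ∑ e : ReducedExp p D (Fin n), (e.1 i : ℕ)
      = ∑ i', ∑ e : ReducedExp p D (Fin n), (e.1 i' : ℕ) := by
        rw [sum_congr rfl fun i' _ => hsymm i', sum_const, card_univ, Fintype.card_fin,
          smul_eq_mul]
    _ = ∑ e : ReducedExp p D (Fin n), ∑ i', (e.1 i' : ℕ) := sum_comm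
    _ ≤ Fintype.card (ReducedExp p D (Fin n)) • D :=
        sum_le_card_nsmul _ _ _ fun e _ => e.2
    _ = _ := by rw [smul_eq_mul, mul_comm]

/-- Dropping `s` of the variables loses at most a fraction `s * D / n` of the monomials. -/
theorem mul_card_reducedExp_le (p D s r : ℕ) :
    (s + r) * Fintype.card (ReducedExp p D (Fin (s + r))) ≤
      (s + r) * Fintype.card (ReducedExp p D (Fin r)) +
        s * D * Fintype.card (ReducedExp p D (Fin (s + r))) := by
  classical
  -- Either no dropped variable occurs, or their exponents sum to at least one.
  have hpt : ∀ e : ReducedExp p D (Fin (s + r)),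
      1 ≤ (if ∀ i : Fin s, (e.1 (Fin.castAdd r i) : ℕ) = 0 then 1 else 0) +
        ∑ i : Fin s, (e.1 (Fin.castAdd r i) : ℕ) := by
    intro e
    split_ifs with h
    · omega
    · push Not at h
      obtain ⟨i, hi⟩ := h
      have := single_le_sum (f := fun i : Fin s => (e.1 (Fin.castAdd r i) : ℕ))
        (fun _ _ => Nat.zero_le _) (mem_univ i)
      omega
  have hsum := sum_le_sum fun e (_ : e ∈ univ) => hpt e
  rw [sum_add_distrib, ← card_filter, sum_comm, sum_const, card_univ, smul_eq_mul, mul_one] at hsum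
  have hcard : #{e : ReducedExp p D (Fin (s + r)) |
      ∀ i : Fin s, (e.1 (Fin.castAdd r i) : ℕ) = 0} ≤ Fintype.card (ReducedExp p D (Fin r)) := by
    rw [← card_univ]
    refine card_le_card_of_injOn (fun e => ⟨fun l => e.1 (Fin.natAdd s l), ?_⟩)
      (fun _ _ => mem_coe.2 (mem_univ _)) ?_
    · have := e.2
      rw [Fin.sum_univ_add] at this
      exact (Nat.le_add_left _ _).trans this
    · intro e he e' he' h
      simp only [coe_filter, mem_univ, true_and, Set.mem_ofPred_eq] at he he'
      apply Subtype.ext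
      funext l
      refine Fin.addCases (fun l => ?_) (fun l => ?_) l
      · apply Fin.ext
        rw [he, he']
      · exact congrFun (congrArg Subtype.val h) l
  calc _ ≤ (s + r) * (Fintype.card (ReducedExp p D (Fin r)) +
        ∑ i : Fin s, ∑ e : ReducedExp p D (Fin (s + r)), (e.1 (Fin.castAdd r i) : ℕ)) :=
        Nat.mul_le_mul_left _ (hsum.trans (Nat.add_le_add_right hcard _))
    _ ≤ _ := by
        rw [mul_add, mul_sum]
        refine Nat.add_le_add_left ?_ _
        refine (sum_le_card_nsmul _ _ _ fun i _ => mul_sum_exponent_le p D (s + r) _).trans ?_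
        rw [card_univ, Fintype.card_fin, smul_eq_mul, mul_assoc]

/-- Lowering a nonzero `i`-th exponent by one is injective into degree at most `D`. -/
theorem sum_exponent_succ_le (p D n : ℕ) (i : Fin n) :
    ∑ e : ReducedExp p (D + 1) (Fin n), (e.1 i : ℕ) ≤
      ∑ e : ReducedExp p D (Fin n), ((e.1 i : ℕ) + 1) := by
  classical
  have hsum : ∀ e : ReducedExp p (D + 1) (Fin n), (e.1 i : ℕ) ≠ 0 →
      ∑ l, (Function.update e.1 i ⟨(e.1 i : ℕ) - 1, by omega⟩ l : ℕ) ≤ D := by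
    intro e he
    have h1 : ∀ l, (Function.update e.1 i ⟨(e.1 i : ℕ) - 1, by omega⟩ l : ℕ) +
        (if l = i then 1 else 0) = e.1 l := by
      intro l
      by_cases hl : l = i
      · subst hl
        simp only [Function.update_self, if_true]
        omega
      · simp [hl]
    have h2 := sum_congr rfl fun l (_ : l ∈ (univ : Finset (Fin n))) => h1 l
    rw [sum_add_distrib] at h2
    simp only [sum_ite_eq', mem_univ, if_true] at h2
    have := e.2
    omega
  let φ : {e : ReducedExp p (D + 1) (Fin n) // (e.1 i : ℕ) ≠ 0} → ReducedExp p D (Fin n) :=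
    fun e => ⟨_, hsum e.1 e.2⟩
  have hφi : ∀ e, ((φ e).1 i : ℕ) + 1 = e.1.1 i := by
    intro e
    have := e.2
    simp only [φ, Function.update_self]
    omega
  have hφ : Function.Injective φ := by
    intro e e' h
    apply Subtype.ext
    apply Subtype.ext
    funext l
    by_cases hl : l = i
    · subst hl
      apply Fin.ext
      rw [← hφi, ← hφi, h]
    · have := congrFun (congrArg Subtype.val h) l
      simpa [φ, hl] using this
  calc ∑ e : ReducedExp p (D + 1) (Fin n), (e.1 i : ℕ)
      = ∑ e : {e : ReducedExp p (D + 1) (Fin n) // (e.1 i : ℕ) ≠ 0}, (e.1.1 i : ℕ) := by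
        rw [← sum_filter_of_ne (p := fun e : ReducedExp p (D + 1) (Fin n) => (e.1 i : ℕ) ≠ 0)
          fun _ _ h => h]
        exact sum_subtype _ (by simp) _
    _ = ∑ e ∈ univ.map ⟨φ, hφ⟩, ((e.1 i : ℕ) + 1) := by
        rw [sum_map]
        exact sum_congr rfl fun e _ => (hφi e).symm
    _ ≤ _ := sum_le_sum_of_subset (subset_univ _)

/-- Growth of the number of monomials with the degree. -/
theorem succ_mul_card_reducedExp_le (p D n : ℕ) :
    (D + 1) * Fintype.card (ReducedExp p (D + 1) (Fin n)) ≤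
      (n + 2 * (D + 1)) * Fintype.card (ReducedExp p D (Fin n)) := by
  classical
  -- A monomial not counted in degree at most `D` has degree exactly `D + 1`, so the total degree
  -- pays for it.
  have hpt : ∀ e : ReducedExp p (D + 1) (Fin n),
      D + 1 ≤ (D + 1) * (if ∑ i, (e.1 i : ℕ) ≤ D then 1 else 0) + ∑ i, (e.1 i : ℕ) := by
    intro e
    split_ifs with h <;> omega
  have hsum := sum_le_sum fun e (_ : e ∈ univ) => hpt e
  rw [sum_const, card_univ, smul_eq_mul, mul_comm, sum_add_distrib, ← mul_sum, ← card_filter,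
    sum_comm] at hsum
  have hcard : #{e : ReducedExp p (D + 1) (Fin n) | ∑ i, (e.1 i : ℕ) ≤ D} ≤
      Fintype.card (ReducedExp p D (Fin n)) := by
    rw [← Fintype.card_subtype]
    refine Fintype.card_le_of_injective (fun e => ⟨e.1.1, e.2⟩) fun e e' h => ?_
    have h' : e.1.1 = e'.1.1 := congrArg (fun z : ReducedExp p D (Fin n) => z.1) h
    exact Subtype.ext (Subtype.ext h')
  have hdeg : ∑ i, ∑ e : ReducedExp p (D + 1) (Fin n), (e.1 i : ℕ) ≤
      (D + n) * Fintype.card (ReducedExp p D (Fin n)) := by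
    calc _ ≤ ∑ i, ∑ e : ReducedExp p D (Fin n), ((e.1 i : ℕ) + 1) :=
          sum_le_sum fun i _ => sum_exponent_succ_le p D n i
      _ = ∑ e : ReducedExp p D (Fin n), ∑ i, ((e.1 i : ℕ) + 1) := sum_comm
      _ ≤ Fintype.card (ReducedExp p D (Fin n)) • (D + n) := by
          refine sum_le_card_nsmul _ _ _ fun e _ => ?_
          rw [sum_add_distrib]
          simpa using e.2
      _ = _ := by rw [smul_eq_mul, mul_comm]
  have := Nat.mul_le_mul_left (D + 1) hcard
  nlinarith

end RMBias

/-! ### Choice of parameters and Markov's inequality. -/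

namespace RMBias

open Finset Module

open Classical in
theorem card_annihilating_mul_le {p : ℕ} [Fact p.Prime] (hp : p ≠ 2) (m r D R : ℕ) (hm : 1 ≤ m)
    (hR : 2 * (R - 1) < Fintype.card (ReducedExp p D (Fin r))) :
    #{x : Fin (4 * R) ⊕ Fin (4 * R) → Fin (m + (m + r)) → ZMod p |
        ∀ f ∈ polys p (D + 1) (m + (m + r)),
          ∑ k, signs p (4 * R) k * MvPolynomial.eval (x k) f = 0} * p ^ (m * R) ≤
      2 * p ^ ((m + (m + r)) * (8 * R)) := by
  have hp3 : 3 ≤ p := by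
    have := (Fact.out : p.Prime).two_le
    omega
  have hcard : Fintype.card (Fin (4 * R) ⊕ Fin (4 * R)) = 8 * R := by
    rw [Fintype.card_sum, Fintype.card_fin]
    ring
  have h := (card_annihilating_le m (m + r) D (signs p (4 * R))).trans
    (card_tensor_relations_le (r := r) (R := R) m hR (Nat.le_add_left _ _) (by omega)
      (signs p (4 * R)) (signs_ne_zero (4 * R)))
  have hsub : 8 * R - R = 7 * R := by omega
  rw [hcard, hsub] at h
  -- Of the saving `7 * m * R` in the low-rank term, `m * R` is claimed; the other `6 * m * R`
  -- absorbs the index sets, as `2 ^ 8 ≤ 3 ^ 6`.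
  have h2 : 2 ^ (8 * R) ≤ p ^ (6 * m * R) := by
    calc 2 ^ (8 * R) = (2 ^ 8) ^ R := by rw [pow_mul]
      _ ≤ (3 ^ 6) ^ R := Nat.pow_le_pow_left (by norm_num) R
      _ = 3 ^ (6 * R) := by rw [pow_mul]
      _ ≤ p ^ (6 * R) := Nat.pow_le_pow_left hp3 _
      _ ≤ p ^ (6 * m * R) := Nat.pow_le_pow_right (by omega) (by nlinarith)
  refine (Nat.mul_le_mul_right (p ^ (m * R)) h).trans ?_
  calc _ = p ^ ((m + (m + r)) * (8 * R)) +
        2 ^ (8 * R) * p ^ ((m + r) * R + r * (7 * R) + 8 * R * m + m * R) := by ring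
    _ ≤ p ^ ((m + (m + r)) * (8 * R)) +
        p ^ (6 * m * R) * p ^ ((m + r) * R + r * (7 * R) + 8 * R * m + m * R) := by gcongr
    _ = _ := by ring

/-- Markov's inequality for the moment of order `8 * R` of the bias. -/
theorem unifProb_bias_le {p : ℕ} [Fact p.Prime] (hp : p ≠ 2) (m r D R : ℕ) (hm : 1 ≤ m)
    (hR : 2 * (R - 1) < Fintype.card (ReducedExp p D (Fin r))) (j : ZMod p) (hj : j ≠ 0)
    (τ : ℝ) (hτ : 0 < τ) :
    unifProb (polys p (D + 1) (m + (m + r)))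
        (fun f => ‖bias p (m + (m + r)) j fun x => MvPolynomial.eval x f‖ > τ) * τ ^ (8 * R) ≤
      2 / (p : ℝ) ^ (m * R) := by
  classical
  set n := m + (m + r)
  set P := (polys_finite p (D + 1) n).toFinset with hP
  have hp0 : (0 : ℝ) < p := by exact_mod_cast (Fact.out : p.Prime).pos
  have hPpos : (0 : ℝ) < #P := by
    have : (0 : MvPolynomial (Fin n) (ZMod p)) ∈ P := by
      rw [hP, Set.Finite.mem_toFinset, mem_polys_iff (NeZero.pos p)]
      simp
    exact_mod_cast card_pos.2 ⟨_, this⟩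
  let B : MvPolynomial (Fin n) (ZMod p) → ℝ := fun f =>
    ‖∑ x, (ZMod.stdAddChar (j * MvPolynomial.eval x f) : ℂ)‖
  have hbias : ∀ f : MvPolynomial (Fin n) (ZMod p),
      ‖bias p n j fun x => MvPolynomial.eval x f‖ = B f / (p : ℝ) ^ n := by
    intro f
    simp only [bias, B, norm_mul, norm_div, norm_one, norm_pow, Complex.norm_natCast]
    ring
  have hprob : unifProb (polys p (D + 1) n)
      (fun f => ‖bias p n j fun x => MvPolynomial.eval x f‖ > τ) =
      #{f ∈ P | ‖bias p n j fun x => MvPolynomial.eval x f‖ > τ} / (#P : ℝ) := by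
    rw [unifProb, Set.ncard_eq_toFinset_card _ (polys_finite p (D + 1) n)]
    have hset : {f | f ∈ polys p (D + 1) n ∧ ‖bias p n j fun x => MvPolynomial.eval x f‖ > τ} =
        (↑({f ∈ P | ‖bias p n j fun x => MvPolynomial.eval x f‖ > τ} : Finset _) : Set _) := by
      ext f
      simp [hP]
    rw [hset, Set.ncard_coe_finset]
  have hmoment := sum_norm_pow_le (d := D + 1) (n := n) (4 * R) j hj
  have hcount := card_annihilating_mul_le hp m r D R hm hR
  set G := #{x : Fin (4 * R) ⊕ Fin (4 * R) → Fin n → ZMod p |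
        ∀ f ∈ polys p (D + 1) n, ∑ k, signs p (4 * R) k * MvPolynomial.eval (x k) f = 0}
  have h8 : 4 * R + 4 * R = 8 * R := by ring
  rw [h8] at hmoment
  have hcount' : (G : ℝ) * (p : ℝ) ^ (m * R) ≤ 2 * (p : ℝ) ^ (n * (8 * R)) := by
    exact_mod_cast hcount
  have hmarkov : (#{f ∈ P | ‖bias p n j fun x => MvPolynomial.eval x f‖ > τ} : ℝ) *
      (τ ^ (8 * R) * (p : ℝ) ^ (n * (8 * R))) ≤ #P * G := by
    refine le_trans ?_ hmoment
    rw [← nsmul_eq_mul]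
    refine (card_nsmul_le_sum _ (fun f => B f ^ (8 * R)) _ fun f hf => ?_).trans
      (sum_le_sum_of_subset_of_nonneg (filter_subset _ _) fun _ _ _ => by positivity)
    have hf := (mem_filter.1 hf).2
    rw [hbias, gt_iff_lt, lt_div_iff₀ (by positivity)] at hf
    rw [pow_mul (p : ℝ) n, ← mul_pow]
    exact pow_le_pow_left₀ (by positivity) hf.le _
  rw [hprob, div_mul_eq_mul_div, div_le_div_iff₀ hPpos (by positivity)]
  refine le_of_mul_le_mul_right ?_ (by positivity : (0 : ℝ) < (p : ℝ) ^ (n * (8 * R)))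
  calc _ = ((#{f ∈ P | ‖bias p n j fun x => MvPolynomial.eval x f‖ > τ} : ℝ) *
      (τ ^ (8 * R) * (p : ℝ) ^ (n * (8 * R)))) * (p : ℝ) ^ (m * R) := by ring
    _ ≤ #P * G * (p : ℝ) ^ (m * R) := by gcongr
    _ = #P * (G * (p : ℝ) ^ (m * R)) := by ring
    _ ≤ #P * (2 * (p : ℝ) ^ (n * (8 * R))) := by gcongr
    _ = _ := by ring

/-- The number of variables that are split off. -/
theorem exists_split {δ : ℝ} (hδ : δ < 1 / 2) {n d : ℕ} (hd : 1 ≤ d) (hdn : (d : ℝ) ≤ δ * n) :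
    ∃ m : ℕ, 1 ≤ m ∧ 2 * m ≤ n ∧ n ≤ 8 * d * m ∧
      2 * (m : ℝ) * d ≤ max (2 * δ) (1 / 2) * n := by
  have hn : 2 * d ≤ n := by
    have : (2 * d : ℝ) ≤ n := by nlinarith [(Nat.cast_nonneg n : (0 : ℝ) ≤ n)]
    exact_mod_cast this
  -- For small `n / d` only `m = 1` is safe, and `δ < 1 / 2` keeps the lost fraction `2 * d / n`
  -- below one; otherwise `m = n / (4 * d)` loses at most half.
  rcases le_or_gt n (8 * d) with h | h
  · refine ⟨1, le_rfl, by omega, by omega, ?_⟩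
    calc 2 * ((1 : ℕ) : ℝ) * d ≤ 2 * δ * n := by push_cast; linarith
      _ ≤ _ := by gcongr; exact le_max_left _ _
  · have h4 : 0 < 4 * d := by omega
    have h1 : 1 ≤ n / (4 * d) := (Nat.one_le_div_iff h4).2 (by omega)
    have h2 : n / (4 * d) * (4 * d) ≤ n := Nat.div_mul_le_self _ _
    have h3 : n < (n / (4 * d) + 1) * (4 * d) := Nat.lt_mul_of_div_lt (Nat.lt_succ_self _) h4
    refine ⟨n / (4 * d), h1, ?_, ?_, ?_⟩
    · nlinarith
    · nlinarith
    · have h2' : ((n / (4 * d) : ℕ) : ℝ) * (4 * d) ≤ n := by exact_mod_cast h2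
      calc 2 * ((n / (4 * d) : ℕ) : ℝ) * d ≤ 1 / 2 * n := by linarith
        _ ≤ _ := by gcongr; exact le_max_right _ _

end RMBias

theorem theorem1 (δ : ℝ) (hδ0 : 0 < δ) (hδ : δ < 1 / 2) :
    ∃ c₁ c₂ : ℝ, 0 < c₁ ∧ 0 < c₂ ∧
      ∀ (p : ℕ) [Fact p.Prime], p ≠ 2 →
        ∀ n d : ℕ, 1 ≤ d → (d : ℝ) ≤ δ * n →
          ∀ j : ZMod p, j ≠ 0 →
            RMBias.unifProb (RMBias.polys p d n)
                (fun f => ‖RMBias.bias p n j (fun x => MvPolynomial.eval x f)‖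
                  > (p : ℝ) ^ (-(c₁ * (n : ℝ) / (d : ℝ))))
              ≤ (p : ℝ) ^ (-(c₂ * ((RMBias.monomials p d n).ncard : ℝ))) := by
  have hκ : 0 < 1 - max (2 * δ) (1 / 2) := by
    rw [sub_pos, max_lt_iff]
    constructor <;> linarith
  set ρ := max (2 * δ) (1 / 2)
  refine ⟨1 / 512, (1 - ρ) / 256, by norm_num, by positivity, ?_⟩
  intro p _ hp n d hd hdn j hj
  have hp3 : (3 : ℝ) ≤ p := by
    have := (Fact.out : p.Prime).two_le
    exact_mod_cast (by omega : 3 ≤ p)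
  have hp0 : (0 : ℝ) < p := by linarith
  obtain ⟨m, hm, hmn, hnm, hmd⟩ := RMBias.exists_split hδ hd hdn
  obtain ⟨r, rfl⟩ : ∃ r, n = m + (m + r) := ⟨n - 2 * m, by omega⟩
  obtain ⟨D, rfl⟩ : ∃ D, d = D + 1 := ⟨d - 1, by omega⟩
  set n := m + (m + r) with hn
  set Mr := Fintype.card (RMBias.ReducedExp p D (Fin r))
  set MD := Fintype.card (RMBias.ReducedExp p D (Fin n)) with hMD
  obtain ⟨R, hR, hMrR⟩ : ∃ R, 2 * (R - 1) < Mr ∧ Mr ≤ 2 * R :=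
    ⟨(Mr + 1) / 2, by have := RMBias.card_reducedExp_pos p D r; omega, by omega⟩
  have hR1 : 1 ≤ R := by
    have : 0 < Mr := RMBias.card_reducedExp_pos p D r
    omega
  have hdrop : n * MD ≤ n * Mr + 2 * m * D * MD := by
    have := RMBias.mul_card_reducedExp_le p D (m + m) r
    rw [add_assoc m m r, ← two_mul m] at this
    exact this
  have hgrow : (D + 1) * (RMBias.monomials p (D + 1) n).ncard ≤ (n + 2 * (D + 1)) * MD := by
    rw [← RMBias.card_reducedExp]
    exact RMBias.succ_mul_card_reducedExp_le p D n
  set M := (RMBias.monomials p (D + 1) n).ncard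
  have hn2 : 2 * ((D : ℝ) + 1) ≤ n := by
    push_cast at hdn
    nlinarith [(Nat.cast_nonneg n : (0 : ℝ) ≤ n)]
  have hD0 : (0 : ℝ) ≤ D := Nat.cast_nonneg D
  have hn0 : (0 : ℝ) < n := by linarith
  have hMRreal : (1 - ρ) * MD ≤ 2 * R := by
    have h1 : (n : ℝ) * MD ≤ n * Mr + 2 * m * D * MD := by exact_mod_cast hdrop
    have h2 : (Mr : ℝ) ≤ 2 * R := by exact_mod_cast hMrR
    have h3 : 2 * (m : ℝ) * D ≤ ρ * n := by
      push_cast at hmd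
      nlinarith [(Nat.cast_nonneg m : (0 : ℝ) ≤ m)]
    have h4 : 2 * (m : ℝ) * D * MD ≤ ρ * n * MD :=
      mul_le_mul_of_nonneg_right h3 (Nat.cast_nonneg MD)
    have h5 : (n : ℝ) * Mr ≤ n * (2 * R) := by gcongr
    refine le_of_mul_le_mul_left ?_ hn0
    linarith
  have hnd : (n : ℝ) / (D + 1 : ℕ) ≤ 8 * m := by
    rw [div_le_iff₀ (by positivity)]
    have : (n : ℝ) ≤ 8 * (D + 1 : ℕ) * m := by exact_mod_cast hnm
    linarith
  -- Lowering the degree by one costs a factor `16 * m`, dropping `2 * m` variables a factor `1 -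
  -- ρ`, and passing to `R` a factor `2`.
  have hmain : (1 - ρ) * M ≤ 32 * (m * R) := by
    have h1 : ((D : ℝ) + 1) * M ≤ (n + 2 * (D + 1)) * MD := by exact_mod_cast hgrow
    have h2 : ((D : ℝ) + 1) * M ≤ (D + 1) * (16 * m * MD) := by
      have h3 : (n : ℝ) ≤ 8 * (D + 1) * m := by exact_mod_cast hnm
      have h4 : ((n : ℝ) + 2 * (D + 1)) * MD ≤ (2 * (8 * (D + 1) * m)) * MD :=
        mul_le_mul_of_nonneg_right (by linarith) (Nat.cast_nonneg MD)
      linarith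
    have h3 : (M : ℝ) ≤ 16 * m * MD := le_of_mul_le_mul_left h2 (by positivity)
    calc (1 - ρ) * M ≤ (1 - ρ) * (16 * m * MD) := by gcongr
      _ = 16 * m * ((1 - ρ) * MD) := by ring
      _ ≤ 16 * m * (2 * R) := by gcongr
      _ = _ := by ring
  have hprob := RMBias.unifProb_bias_le hp m r D R hm hR j hj
    ((p : ℝ) ^ (-(1 / 512 * (n : ℝ) / ((D + 1 : ℕ) : ℝ)))) (by positivity)
  rw [← Real.rpow_mul_natCast hp0.le, ← Real.rpow_natCast, ← le_div_iff₀ (by positivity)] at hprob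
  refine hprob.trans ?_
  have hmR : (1 : ℝ) ≤ m * R := by exact_mod_cast Nat.mul_pos hm hR1
  -- The exponent `m * R` is split as `3 / 4` for the factor `2` (from `16 ≤ 27`), `1 / 8` for the
  -- threshold and `1 / 8` for the final bound; this fixes `c₁` and `c₂`.
  have htwo : (2 : ℝ) ≤ (p : ℝ) ^ ((3 / 4 : ℝ) * (m * R)) := by
    calc (2 : ℝ) = ((16 : ℝ)) ^ (1 / 4 : ℝ) := by
          rw [show (16 : ℝ) = 2 ^ (4 : ℝ) by norm_num, ← Real.rpow_mul (by norm_num)]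
          norm_num
      _ ≤ (27 : ℝ) ^ (1 / 4 : ℝ) := by gcongr; norm_num
      _ = (3 : ℝ) ^ (3 / 4 : ℝ) := by
          rw [show (27 : ℝ) = 3 ^ (3 : ℝ) by norm_num, ← Real.rpow_mul (by norm_num)]
          norm_num
      _ ≤ (p : ℝ) ^ (3 / 4 : ℝ) := by gcongr
      _ ≤ _ := Real.rpow_le_rpow_of_exponent_le (by linarith) (by linarith)
  rw [div_div, div_le_iff₀ (by positivity), ← Real.rpow_add hp0, ← Real.rpow_add hp0]
  refine htwo.trans (Real.rpow_le_rpow_of_exponent_le (by linarith) ?_)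
  have hexp : 1 / 512 * (n : ℝ) / ((D + 1 : ℕ) : ℝ) * ((8 * R : ℕ) : ℝ) ≤ 1 / 8 * (m * R) := by
    calc 1 / 512 * (n : ℝ) / ((D + 1 : ℕ) : ℝ) * ((8 * R : ℕ) : ℝ)
        = 1 / 64 * (n / ((D + 1 : ℕ) : ℝ)) * R := by push_cast; ring
      _ ≤ 1 / 64 * (8 * m) * R := by gcongr
      _ = _ := by ring
  rw [Nat.cast_mul m R]
  linarith
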